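/- Let $X=(X_t)_{t\ge0}$ be an irreducible, aperiodic, discrete time Markov chain on a finite state space $S$ with $|S|\ge2$, transition matrix $P$ and stationary distribution $\pi$. Fix $j\in S$, let $\delta_l$ denote the point mass at $l$, and put $\pi^{(j)}=(\pi-\pi_j\delta_j)/(1-\pi_j)$. Let $W_j=\inf\{t\ge0:X_t=j\}$, where $X_0\sim\pi$. A strong stationary time from an initial distribution $\nu$ is an almost surely finite randomized stopping time $T$ for a chain $X$ with transition matrix $P$ and $X_0\sim\nu$, such that $X_T\sim\pi$ and $X_T$ is independent of $T$; it is called fastest if it is stochastically smaller than every strong stationary time from $\nu$. For each $l\ne j$ let $T_{(l)}$ be any strong stationary time from $\delta_l$. All expectations below take values in $[0,\infty]$. (i) For every strong stationary time $T^{(j)}$ from $\pi^{(j)}$, $$\mathbb{E}W_j\le\frac{1-\pi_j}{\pi_j}\,\mathbb{E}T^{(j)}.$$ If moreover $T^{(j)}$ is a fastest strong stationary time from $\pi^{(j)}$, then $$\frac{1-\pi_j}{\pi_j}\,\mathbb{E}T^{(j)}\le\frac1{\pi_j}\sum_{l\ne j}\pi_l\,\mathbb{E}T_{(l)}.$$ In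 particular, in all cases, $\mathbb{E}W_j\le\frac1{\pi_j}\sum_{l\ne j}\pi_l\,\mathbb{E}T_{(l)}$. (ii) Let $T^{(j)}$ be any strong stationary time from $\pi^{(j)}$. If $\theta>0$ is such that $(1-\pi_j)\,\mathbb{E}e^{\theta T^{(j)}}<1$, then $$\mathbb{E}e^{\theta W_j}\le\frac{\pi_j}{1-(1-\pi_j)\,\mathbb{E}e^{\theta T^{(j)}}}.$$ -/

import Mathlib

open MeasureTheory ProbabilityTheory
open scoped ENNReal

noncomputable section

namespace HittingChain

/-- Every state has period one: the only common divisor of the possible return times is `1`. -/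
def IsAperiodic {S : Type*} [Fintype S] [DecidableEq S] (P : Matrix S S ℝ) : Prop :=
  ∀ i : S, ∀ d : ℕ, (∀ n : ℕ, 0 < n → 0 < (P ^ n) i i → d ∣ n) → d = 1

/-- `p` is a probability distribution on `S` with `p P = p`. -/
def IsStationaryDistribution {S : Type*} [Fintype S] (P : Matrix S S ℝ) (p : S → ℝ) : Prop :=
  p ∈ stdSimplex ℝ S ∧ Matrix.vecMul p P = p

/-- The distribution `p` restricted to the states other than `j`: `(p - p_j δ_j) / (1 - p_j)`. -/
def restrictAway {S : Type*} [DecidableEq S] (p : S → ℝ) (j : S) : S → ℝ :=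
  (1 - p j)⁻¹ • (p - p j • Pi.single j 1)

/-- Under `μ`, the process `X` is a Markov chain with transition matrix `P` and initial
distribution `ν`:
`μ(X_0 = x_0, …, X_n = x_n) = ν(x_0) P(x_0, x_1) ⋯ P(x_{n-1}, x_n)` for all `n` and all paths. -/
structure IsMarkovChain {S Ω : Type*} [MeasurableSpace Ω] (P : Matrix S S ℝ) (ν : S → ℝ)
    (X : ℕ → Ω → S) (μ : Measure Ω) : Prop where
  measurableSet_eq : ∀ t i, MeasurableSet {ω | X t ω = i}
  path_law : ∀ (n : ℕ) (x : ℕ → S), μ {ω | ∀ t ≤ n, X t ω = x t} =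
    ENNReal.ofReal (ν (x 0) * ∏ t ∈ Finset.range n, P (x t) (x (t + 1)))

/-- The process `X` is adapted to the filtration `ℱ` and has the Markov property with transition
matrix `P` relative to `ℱ`: given `ℱ_t`, the conditional law of `X_{t+1}` is `P(X_t, ·)`. As the
state space is finite, this is tested on the events `A ∩ {X_t = i}` with `A ∈ ℱ_t`. -/
structure IsMarkovWrt {S Ω : Type*} [m : MeasurableSpace Ω] (ℱ : Filtration ℕ m)
    (P : Matrix S S ℝ) (X : ℕ → Ω → S) (μ : Measure Ω) : Prop where
  adapted : ∀ t i, MeasurableSet[ℱ t] {ω | X t ω = i}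
  markov : ∀ (t : ℕ) (A : Set Ω), MeasurableSet[ℱ t] A → ∀ i k : S,
    μ (A ∩ {ω | X t ω = i} ∩ {ω | X (t + 1) ω = k}) =
      μ (A ∩ {ω | X t ω = i}) * ENNReal.ofReal (P i k)

/-- `T` is a randomized stopping time for `X`: a stopping time for some filtration, possibly
larger than the one generated by `X`, relative to which `X` still has the Markov property. -/
def IsRandomizedStoppingTime {S Ω : Type*} [m : MeasurableSpace Ω] (P : Matrix S S ℝ)
    (X : ℕ → Ω → S) (T : Ω → ℕ∞) (μ : Measure Ω) : Prop :=
  ∃ ℱ : Filtration ℕ m, IsMarkovWrt ℱ P X μ ∧ IsStoppingTime ℱ T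

/-- `T` is a strong stationary time for the Markov chain `X` with transition matrix `P` and initial
distribution `ν`: an almost surely finite randomized stopping time such that `X_T` has law `p`
(the stationary distribution) and `X_T` is independent of `T`. -/
structure IsStrongStationaryTime {S Ω : Type*} [MeasurableSpace Ω] (P : Matrix S S ℝ)
    (p ν : S → ℝ) (X : ℕ → Ω → S) (T : Ω → ℕ∞) (μ : Measure Ω) : Prop where
  chain : IsMarkovChain P ν X μ
  stopping : IsRandomizedStoppingTime P X T μ
  finite : ∀ᵐ ω ∂μ, T ω ≠ ⊤
  law : ∀ i, μ {ω | stoppedValue X T ω = i} = ENNReal.ofReal (p i)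
  indep : ∀ (t : ℕ) (i : S), μ {ω | T ω = t ∧ stoppedValue X T ω = i} =
    μ {ω | T ω = t} * μ {ω | stoppedValue X T ω = i}

/-- The usual stochastic order `T ≤_st T'` between random times (possibly on different spaces):
`E h(T) ≤ E h(T')` for all increasing `h`. On `{0, 1, 2, …}` increasing functions are bounded below,
so nonnegative `h` suffice, and then the expectations always exist in `[0, ∞]`. -/
def StochLE {Ω Ω' : Type*} [MeasurableSpace Ω] [MeasurableSpace Ω'] (T : Ω → ℕ∞) (μ : Measure Ω)
    (T' : Ω' → ℕ∞) (μ' : Measure Ω') : Prop :=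
  ∀ h : ℕ∞ → ℝ≥0∞, Monotone h → ∫⁻ ω, h (T ω) ∂μ ≤ ∫⁻ ω, h (T' ω) ∂μ'

/-- `T` is a fastest strong stationary time: stochastically smaller than every strong stationary
time for a chain with the same transition matrix and initial distribution. (The joint law of such a
chain and time lives on a space of sequences, so competitors on spaces in `Type` suffice.) -/
def IsFastestStrongStationaryTime {S Ω : Type*} [MeasurableSpace Ω] (P : Matrix S S ℝ)
    (p ν : S → ℝ) (X : ℕ → Ω → S) (T : Ω → ℕ∞) (μ : Measure Ω) : Prop :=
  IsStrongStationaryTime P p ν X T μ ∧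
    ∀ (Ω' : Type) [MeasurableSpace Ω'] (μ' : Measure Ω') [IsProbabilityMeasure μ']
      (X' : ℕ → Ω' → S) (T' : Ω' → ℕ∞),
      IsStrongStationaryTime P p ν X' T' μ' → StochLE T μ T' μ'

/-- The hitting time `inf {t ≥ 0 : X_t = j}`, equal to `∞` when `j` is never visited. -/
def hittingTime {S Ω : Type*} (X : ℕ → Ω → S) (j : S) : Ω → ℕ∞ :=
  hittingAfter X {j} 0

/-- The expectation `E T ∈ [0, ∞]`. -/
def mean {Ω : Type*} [MeasurableSpace Ω] (T : Ω → ℕ∞) (μ : Measure Ω) : ℝ≥0∞ :=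
  ∫⁻ ω, (T ω : ℝ≥0∞) ∂μ

/-- The exponential moment `E e^{θ T} ∈ [0, ∞]`, with `e^∞ = ∞`. -/
def expMoment {Ω : Type*} [MeasurableSpace Ω] (θ : ℝ) (T : Ω → ℕ∞) (μ : Measure Ω) : ℝ≥0∞ :=
  ∫⁻ ω, EReal.exp ((θ : EReal) * ((T ω : ℝ≥0∞) : EReal)) ∂μ

end HittingChain

end

/-! Write `q = 1 - p j`. Everything follows from comparing the hitting time `W` of `j` with `B (T +
W')`, where `W'` is a copy of `W`, `B` is Bernoulli with mean `q`, and `B`, `T`, `W'` are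
independent (`measure_hittingTime_tail_le`).

Decomposing `{X n = j}` by the first visit gives `∑ l ≤ n, P(W = l) (P ^ (n - l)) j j = p j`. Since
`p` is the mixture of `δ_j` and `restrictAway p j` with weights `p j` and `q`, and a chain is
stationary from a strong stationary time onwards, `(P ^ k) j j + q P(T ≤ k) ≤ 1`. Inserting this
into `P(W ≤ n) = ∑ l ≤ n, P(W = l)` yields `P(W ≤ n) ≥ p j + q P(T + W' ≤ n)`, which is the
comparison.

It is a defective renewal inequality for the tails of `W`. Multiplying by `a ^ n` and summing bounds
`∑ a ^ n P(W > n)` (`tsum_pow_mul_le_of_renewal`); `a = 1` gives the mean and `a = exp θ` the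
exponential moment.

For the bound by the times `T₂ l`, mixing them with weights `p l / (1 - p j)` is again a strong
stationary time from `restrictAway p j`, with the averaged mean. It can be used as `T`, and a
fastest time is stochastically below it. -/

namespace HittingChain

/-! ### Multi-step Markov property and the natural filtration -/

section Markov

/-- Decomposition of a measure along the fibres of a map to a finite type. -/
theorem measure_eq_sum_fiber {S : Type*} [Fintype S] {Ω : Type*} [MeasurableSpace Ω] (μ : Measure Ω) {Y : Ω → S}
    (hY : ∀ i, MeasurableSet {ω | Y ω = i}) {A : Set Ω} (hA : MeasurableSet A) :
    μ A = ∑ i, μ (A ∩ {ω | Y ω = i}) := by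
  rw [← measure_biUnion_finset _ fun i _ => hA.inter (hY i)]
  · congr 1
    ext ω
    simp
  · intro i _ k _ hik
    refine Set.disjoint_left.2 fun ω h₁ h₂ => hik ?_
    exact h₁.2.symm.trans h₂.2

theorem pow_nonneg_of_rowStochastic {S : Type*} [Fintype S] [DecidableEq S] {P : Matrix S S ℝ}
    (hP : P ∈ Matrix.rowStochastic ℝ S) (n : ℕ) (i k : S) : 0 ≤ (P ^ n) i k :=
  Matrix.nonneg_of_mem_rowStochastic (pow_mem hP n)

theorem vecMul_pow_of_stationary {S : Type*} [Fintype S] [DecidableEq S] {P : Matrix S S ℝ} {p : S → ℝ}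
    (hp : IsStationaryDistribution P p) (n : ℕ) : Matrix.vecMul p (P ^ n) = p := by
  induction n with
  | zero => simp
  | succ n ih => rw [pow_succ, ← Matrix.vecMul_vecMul, ih, hp.2]

theorem sum_ofReal_mul_pow_of_stationary {S : Type*} [Fintype S] [DecidableEq S] {P : Matrix S S ℝ}
    (hP : P ∈ Matrix.rowStochastic ℝ S) {p : S → ℝ} (hp : IsStationaryDistribution P p)
    (n : ℕ) (k : S) :
    ∑ i, ENNReal.ofReal (p i) * ENNReal.ofReal ((P ^ n) i k) = ENNReal.ofReal (p k) := by
  simp_rw [← ENNReal.ofReal_mul (hp.1.1 _)]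
  rw [← ENNReal.ofReal_sum_of_nonneg fun i _ =>
    mul_nonneg (hp.1.1 i) (pow_nonneg_of_rowStochastic hP n i k)]
  congr 1
  exact congrFun (vecMul_pow_of_stationary hp n) k

/-- The Markov property over several steps. -/
theorem IsMarkovWrt.measure_inter {S : Type*} [Fintype S] [DecidableEq S] {Ω : Type*} [m : MeasurableSpace Ω]
    {ℱ : Filtration ℕ m} {P : Matrix S S ℝ} (hP : P ∈ Matrix.rowStochastic ℝ S) {X : ℕ → Ω → S}
    {μ : Measure Ω} (h : IsMarkovWrt ℱ P X μ) (t n : ℕ) {A : Set Ω} (hA : MeasurableSet[ℱ t] A)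
    (i k : S) :
    μ (A ∩ {ω | X t ω = i} ∩ {ω | X (t + n) ω = k}) =
      μ (A ∩ {ω | X t ω = i}) * ENNReal.ofReal ((P ^ n) i k) := by
  have hmeas : ∀ s i, MeasurableSet {ω | X s ω = i} := fun s i => ℱ.le s _ (h.adapted s i)
  have hB : MeasurableSet[ℱ t] (A ∩ {ω | X t ω = i}) := hA.inter (h.adapted t i)
  induction n generalizing k with
  | zero =>
    rcases eq_or_ne i k with rfl | hik
    · rw [add_zero, Set.inter_assoc, Set.inter_self]
      simp
    · have : A ∩ {ω | X t ω = i} ∩ {ω | X (t + 0) ω = k} = ∅ := by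
        ext ω
        simp only [add_zero, Set.mem_inter_iff, Set.mem_ofPred_eq, Set.mem_empty_iff_false,
          iff_false, not_and]
        rintro ⟨-, h₁⟩ h₂
        exact hik (h₁.symm.trans h₂)
      rw [this]
      simp [Matrix.one_apply_ne hik]
  | succ n ih =>
    rw [measure_eq_sum_fiber μ (hmeas (t + n)) ((ℱ.le t _ hB).inter (hmeas (t + (n + 1)) k))]
    have hstep : ∀ l, μ (A ∩ {ω | X t ω = i} ∩ {ω | X (t + (n + 1)) ω = k} ∩
        {ω | X (t + n) ω = l}) = μ (A ∩ {ω | X t ω = i}) *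
          ENNReal.ofReal ((P ^ n) i l * P l k) := by
      intro l
      rw [Set.inter_right_comm, ← add_assoc,
        h.markov (t + n) _ (ℱ.mono (Nat.le_add_right t n) _ hB) l k, ih,
        ENNReal.ofReal_mul (pow_nonneg_of_rowStochastic hP n i l), mul_assoc]
    simp_rw [hstep]
    rw [← Finset.mul_sum, pow_succ, Matrix.mul_apply, ENNReal.ofReal_sum_of_nonneg]
    exact fun l _ => mul_nonneg (pow_nonneg_of_rowStochastic hP n i l)
      (Matrix.nonneg_of_mem_rowStochastic hP)

theorem IsMarkovChain.measure_zero {S : Type*} {Ω : Type*} [MeasurableSpace Ω] {P : Matrix S S ℝ} {ν : S → ℝ}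
    {X : ℕ → Ω → S} {μ : Measure Ω} (h : IsMarkovChain P ν X μ) (i : S) :
    μ {ω | X 0 ω = i} = ENNReal.ofReal (ν i) := by
  simpa using h.path_law 0 fun _ => i

/-- The law of a Markov chain at time `n`. -/
theorem IsMarkovWrt.measure_eq {S : Type*} [Fintype S] [DecidableEq S] {Ω : Type*} [m : MeasurableSpace Ω]
    {ℱ : Filtration ℕ m} {P : Matrix S S ℝ} (hP : P ∈ Matrix.rowStochastic ℝ S) {ν : S → ℝ}
    {X : ℕ → Ω → S} {μ : Measure Ω} (h : IsMarkovWrt ℱ P X μ) (hX : IsMarkovChain P ν X μ)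
    (n : ℕ) (k : S) :
    μ {ω | X n ω = k} = ∑ i, ENNReal.ofReal (ν i) * ENNReal.ofReal ((P ^ n) i k) := by
  rw [measure_eq_sum_fiber μ (hX.measurableSet_eq 0) (hX.measurableSet_eq n k)]
  refine Finset.sum_congr rfl fun i _ => ?_
  have := h.measure_inter hP 0 n MeasurableSet.univ i k
  rwa [Set.univ_inter, zero_add, Set.inter_comm, hX.measure_zero] at this

/-- The history of a process up to time `t`. -/
def history {S Ω : Type*} (X : ℕ → Ω → S) (t : ℕ) (ω : Ω) : Fin (t + 1) → S := fun s => X s ω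

theorem measurableSet_history_eq {S : Type*} {Ω : Type*} [MeasurableSpace Ω] {X : ℕ → Ω → S}
    (hX : ∀ t i, MeasurableSet {ω | X t ω = i}) (t : ℕ) (y : Fin (t + 1) → S) :
    MeasurableSet {ω | history X t ω = y} := by
  have : {ω | history X t ω = y} = ⋂ s : Fin (t + 1), {ω | X s ω = y s} := by
    ext ω
    simp [history, funext_iff]
  rw [this]
  exact MeasurableSet.iInter fun s => hX s (y s)

/-- The filtration generated by a process with values in a finite type. -/
def naturalFiltration {S : Type*} [Fintype S] {Ω : Type*} [m : MeasurableSpace Ω] {X : ℕ → Ω → S}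
    (hX : ∀ t i, MeasurableSet {ω | X t ω = i}) : Filtration ℕ m where
  seq t := MeasurableSpace.comap (history X t) ⊤
  mono' := by
    rintro s t hst A ⟨B, -, rfl⟩
    exact ⟨{y | (fun r : Fin (s + 1) => y ⟨r, by omega⟩) ∈ B}, trivial, rfl⟩
  le' := by
    rintro t A ⟨B, -, rfl⟩
    have : history X t ⁻¹' B = ⋃ y ∈ B, {ω | history X t ω = y} := by
      ext ω
      simp
    rw [this]
    exact B.toFinite.measurableSet_biUnion fun y _ => measurableSet_history_eq hX t y

/-- The path law of length `t + 1` is that of length `t` times one more transition factor. This is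
the Markov property on the atoms of the natural filtration. -/
theorem IsMarkovChain.measure_history {S : Type*} {Ω : Type*} [MeasurableSpace Ω] {P : Matrix S S ℝ}
    (hP : ∀ i k, 0 ≤ P i k) {ν : S → ℝ} {X : ℕ → Ω → S} {μ : Measure Ω}
    (h : IsMarkovChain P ν X μ) (t : ℕ) (y : Fin (t + 1) → S) (k : S) :
    μ ({ω | history X t ω = y} ∩ {ω | X (t + 1) ω = k}) =
      μ {ω | history X t ω = y} * ENNReal.ofReal (P (y (Fin.last t)) k) := by
  -- The path law is stated for infinite paths, so `y` is continued by the constant `k`; only the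
  -- value at `t + 1` matters.
  let x : ℕ → S := fun s => if hs : s < t + 1 then y ⟨s, hs⟩ else k
  have h₁ : {ω | history X t ω = y} = {ω | ∀ s ≤ t, X s ω = x s} := by
    ext ω
    simp only [history, funext_iff, Set.mem_ofPred_eq, x]
    constructor
    · intro H s hs
      rw [dif_pos (by omega)]
      exact H ⟨s, by omega⟩
    · intro H s
      have := H s (by omega)
      rwa [dif_pos s.2] at this
  have h₂ : {ω | ∀ s ≤ t, X s ω = x s} ∩ {ω | X (t + 1) ω = k} =
      {ω | ∀ s ≤ t + 1, X s ω = x s} := by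
    ext ω
    have hx : x (t + 1) = k := by simp [x]
    simp only [Set.mem_inter_iff, Set.mem_ofPred_eq]
    constructor
    · rintro ⟨H₁, H₂⟩ s hs
      rcases Nat.le_succ_iff.1 hs with hs | rfl
      · exact H₁ s hs
      · rw [hx]; exact H₂
    · intro H
      exact ⟨fun s hs => H s (by omega), by rw [← hx]; exact H _ le_rfl⟩
  have hxt : x t = y (Fin.last t) := by
    simp only [x]
    rw [dif_pos (by omega)]
    rfl
  have hxt' : x (t + 1) = k := by simp [x]
  rw [h₁, h₂, h.path_law, h.path_law, Finset.prod_range_succ, ← mul_assoc,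
    ENNReal.ofReal_mul' (hP _ _), hxt, hxt']

/-- A Markov chain has the Markov property relative to its natural filtration. -/
theorem IsMarkovChain.isMarkovWrt {S : Type*} [Fintype S] {Ω : Type*} [MeasurableSpace Ω] {P : Matrix S S ℝ}
    (hP : ∀ i k, 0 ≤ P i k) {ν : S → ℝ} {X : ℕ → Ω → S} {μ : Measure Ω}
    (h : IsMarkovChain P ν X μ) :
    IsMarkovWrt (naturalFiltration h.measurableSet_eq) P X μ where
  adapted t i := ⟨{y | y (Fin.last t) = i}, trivial, rfl⟩
  markov := by
    rintro t A ⟨B, -, rfl⟩ i k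
    classical
    have hmeas := measurableSet_history_eq h.measurableSet_eq t
    have hA : MeasurableSet (history X t ⁻¹' B ∩ {ω | X t ω = i}) :=
      ((naturalFiltration h.measurableSet_eq).le t _ ⟨B, trivial, rfl⟩).inter
        (h.measurableSet_eq t i)
    rw [measure_eq_sum_fiber μ hmeas (hA.inter (h.measurableSet_eq (t + 1) k)),
      measure_eq_sum_fiber μ hmeas hA, Finset.sum_mul]
    refine Finset.sum_congr rfl fun y _ => ?_
    rw [Set.inter_right_comm]
    -- The fibre of `y` is an atom: it lies inside the event or misses it.
    by_cases hy : y ∈ B ∧ y (Fin.last t) = i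
    · have : history X t ⁻¹' B ∩ {ω | X t ω = i} ∩ {ω | history X t ω = y} =
          {ω | history X t ω = y} := by
        refine Set.inter_eq_right.2 ?_
        rintro ω rfl
        exact ⟨hy.1, hy.2⟩
      rw [this, h.measure_history hP, hy.2]
    · have : history X t ⁻¹' B ∩ {ω | X t ω = i} ∩ {ω | history X t ω = y} = ∅ := by
        refine Set.eq_empty_of_forall_notMem ?_
        rintro ω ⟨⟨h₁, h₂⟩, rfl⟩
        exact hy ⟨h₁, h₂⟩
      rw [this]
      simp

end Markov

/-! ### Renewal inequality, tail sums and moments -/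

section Tail

/-- The left side sums over the triangle of index pairs with total below `N`, which lies inside the
square on the right. -/
theorem sum_range_sum_mul_sub_le (f g : ℕ → ℝ≥0∞) (N : ℕ) :
    ∑ n ∈ Finset.range N, ∑ k ∈ Finset.range (n + 1), f k * g (n - k) ≤
      (∑ k ∈ Finset.range N, f k) * ∑ i ∈ Finset.range N, g i := by
  rw [Finset.sum_comm' (t' := Finset.range N) (s' := fun k => Finset.Ico k N)
    (by intro x y; simp only [Finset.mem_range, Finset.mem_Ico]; omega), Finset.sum_mul]
  refine Finset.sum_le_sum fun k _ => ?_
  rw [← Finset.mul_sum, Finset.sum_Ico_eq_sum_range]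
  gcongr with i hi
  · refine (Finset.sum_le_sum_of_subset (Finset.range_subset_range.2 (Nat.sub_le N k))).trans_eq' ?_
    exact Finset.sum_congr rfl fun i _ => by rw [Nat.add_sub_cancel_left]

/-- A defective renewal inequality for `w` bounds its generating function. -/
theorem tsum_pow_mul_le_of_renewal {w s t : ℕ → ℝ≥0∞} {a q m : ℝ≥0∞} (ha : a ≠ ∞)
    (hw : ∀ n, w n ≠ ∞) (hqm : q * m < 1) (hm : ∀ N, ∑ k ∈ Finset.range N, a ^ k * t k ≤ m)
    (h : ∀ n, w n ≤ q * (s n + ∑ k ∈ Finset.range (n + 1), t k * w (n - k))) :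
    ∑' n, a ^ n * w n ≤ q * (∑' n, a ^ n * s n) / (1 - q * m) := by
  rw [ENNReal.tsum_eq_iSup_nat]
  refine iSup_le fun N => ?_
  -- The full series might be infinite, so the argument runs on partial sums: these are finite and
  -- can be subtracted in `ℝ≥0∞`. The convolution up to `n < N` only involves `w i` with `i < N`, so
  -- the inequality closes on `A` itself.
  set A := ∑ n ∈ Finset.range N, a ^ n * w n with hA
  have hfin : A ≠ ∞ := by
    rw [hA]
    exact ENNReal.sum_ne_top.2 fun n _ => ENNReal.mul_ne_top (ENNReal.pow_ne_top ha) (hw n)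
  have hstep : A ≤ q * (∑' n, a ^ n * s n) + q * m * A := by
    calc A ≤ ∑ n ∈ Finset.range N, (q * (a ^ n * s n) +
          q * ∑ k ∈ Finset.range (n + 1), (a ^ k * t k) * (a ^ (n - k) * w (n - k))) := by
          refine Finset.sum_le_sum fun n _ => ?_
          refine (mul_le_mul_right (h n) (a ^ n)).trans_eq ?_
          rw [mul_left_comm, mul_add, mul_add, Finset.mul_sum]
          congr 2
          refine Finset.sum_congr rfl fun k hk => ?_
          have : a ^ n = a ^ k * a ^ (n - k) := by
            rw [← pow_add, Nat.add_sub_cancel' (Nat.lt_succ_iff.1 (Finset.mem_range.1 hk))]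
          rw [this]
          ring
      _ ≤ q * (∑' n, a ^ n * s n) + q * (m * A) := by
          rw [Finset.sum_add_distrib, ← Finset.mul_sum, ← Finset.mul_sum]
          gcongr
          · exact ENNReal.sum_le_tsum _
          · refine (sum_range_sum_mul_sub_le (fun k => a ^ k * t k) (fun i => a ^ i * w i) N).trans ?_
            gcongr
            exact hm N
      _ = _ := by rw [mul_assoc]
  rw [ENNReal.le_div_iff_mul_le (Or.inl (tsub_pos_of_lt hqm).ne')
    (Or.inl (ne_top_of_le_ne_top ENNReal.one_ne_top tsub_le_self)), mul_comm,
    ENNReal.sub_mul fun _ _ => hfin, one_mul]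
  exact tsub_le_iff_right.2 hstep

/-- Tonelli for the discrete layer-cake formula. The integrand is `∑ n < T, c n`: weights `1`
recover `T`, and weights `a ^ n` recover `a ^ T` through the geometric sum. -/
theorem lintegral_tsum_tail {Ω : Type*} [MeasurableSpace Ω] (μ : Measure Ω) {T : Ω → ℕ∞}
    (hT : ∀ n : ℕ, MeasurableSet {ω | (n : ℕ∞) < T ω}) (c : ℕ → ℝ≥0∞) :
    ∫⁻ ω, ∑' n : ℕ, {ω | (n : ℕ∞) < T ω}.indicator (fun _ => c n) ω ∂μ =
      ∑' n : ℕ, c n * μ {ω | (n : ℕ∞) < T ω} := by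
  rw [lintegral_tsum fun n => (measurable_const.indicator (hT n)).aemeasurable]
  exact tsum_congr fun n => lintegral_indicator_const (hT n) _

theorem tsum_indicator_tail_natCast {Ω : Type*} {T : Ω → ℕ∞} (c : ℕ → ℝ≥0∞) {ω : Ω} {k : ℕ}
    (hk : T ω = k) :
    ∑' n : ℕ, {ω | (n : ℕ∞) < T ω}.indicator (fun _ => c n) ω = ∑ n ∈ Finset.range k, c n := by
  rw [tsum_eq_sum (s := Finset.range k)]
  · refine Finset.sum_congr rfl fun n hn => Set.indicator_of_mem ?_ _
    simpa [hk] using hn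
  · intro n hn
    refine Set.indicator_of_notMem ?_ _
    simpa [hk] using hn

theorem tsum_indicator_tail_top {Ω : Type*} {T : Ω → ℕ∞} (c : ℕ → ℝ≥0∞) {ω : Ω} (hk : T ω = ⊤) :
    ∑' n : ℕ, {ω | (n : ℕ∞) < T ω}.indicator (fun _ => c n) ω = ∑' n, c n :=
  tsum_congr fun n => Set.indicator_of_mem (by simp [hk]) _

theorem mean_eq_tsum {Ω : Type*} [MeasurableSpace Ω] (μ : Measure Ω) {T : Ω → ℕ∞}
    (hT : ∀ n : ℕ, MeasurableSet {ω | (n : ℕ∞) < T ω}) :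
    mean T μ = ∑' n : ℕ, μ {ω | (n : ℕ∞) < T ω} := by
  have := lintegral_tsum_tail μ hT fun _ => 1
  simp only [one_mul] at this
  rw [← this, mean]
  refine lintegral_congr fun ω => ?_
  cases hω : T ω using ENat.recTopCoe with
  | top => rw [tsum_indicator_tail_top _ hω]; simp
  | coe k => rw [tsum_indicator_tail_natCast _ hω]; simp

theorem exp_mul_natCast (θ : ℝ) (k : ℕ) :
    EReal.exp ((θ : EReal) * (((k : ℕ∞) : ℝ≥0∞) : EReal)) = ENNReal.ofReal (Real.exp θ) ^ k := by
  have h : (((k : ℕ∞) : ℝ≥0∞) : EReal) = ((k : ℝ) : EReal) := by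
    rw [ENat.toENNReal_coe]
    norm_cast
  rw [h, ← EReal.coe_mul, EReal.exp_coe, ← ENNReal.ofReal_pow (Real.exp_nonneg _),
    ← Real.exp_nat_mul, mul_comm]

theorem exp_mul_top {θ : ℝ} (hθ : 0 < θ) :
    EReal.exp ((θ : EReal) * (((⊤ : ℕ∞) : ℝ≥0∞) : EReal)) = ∞ := by
  simp [EReal.coe_mul_top_of_pos hθ]

theorem one_add_mul_geom_sum {a : ℝ≥0∞} (ha : 1 ≤ a) (k : ℕ) :
    1 + (a - 1) * ∑ n ∈ Finset.range k, a ^ n = a ^ k := by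
  induction k with
  | zero => simp
  | succ k ih =>
    rw [Finset.sum_range_succ, mul_add, ← add_assoc, ih, pow_succ]
    nth_rw 1 [← mul_one (a ^ k)]
    rw [mul_comm (a - 1), ← mul_add, add_tsub_cancel_of_le ha]

theorem expMoment_eq_tsum {Ω : Type*} [MeasurableSpace Ω] (μ : Measure Ω) [IsProbabilityMeasure μ] {T : Ω → ℕ∞}
    (hT : ∀ n : ℕ, MeasurableSet {ω | (n : ℕ∞) < T ω}) {θ : ℝ} (hθ : 0 < θ) :
    expMoment θ T μ = 1 + (ENNReal.ofReal (Real.exp θ) - 1) *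
      ∑' n : ℕ, ENNReal.ofReal (Real.exp θ) ^ n * μ {ω | (n : ℕ∞) < T ω} := by
  set a := ENNReal.ofReal (Real.exp θ) with ha
  have ha1 : 1 < a := by
    rw [ha, ENNReal.one_lt_ofReal]
    exact Real.one_lt_exp_iff.2 hθ
  have hc : a - 1 ≠ 0 := (tsub_pos_of_lt ha1).ne'
  rw [← lintegral_tsum_tail μ hT, ← lintegral_const_mul', expMoment]
  · have hone : ∫⁻ _, 1 ∂μ = 1 := by simp
    -- The constant `1` becomes an integral, so that the identity can be checked pointwise.
    conv_rhs => arg 1; rw [← hone]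
    rw [← lintegral_add_left measurable_const]
    refine lintegral_congr fun ω => ?_
    cases hω : T ω using ENat.recTopCoe with
    | top =>
      rw [tsum_indicator_tail_top _ hω, exp_mul_top hθ]
      -- Where `T = ∞` both sides are infinite, because `a > 1` makes the series diverge and keeps
      -- its coefficient `a - 1` nonzero.
      have : ∑' n : ℕ, a ^ n = ∞ := by
        refine top_unique ?_
        calc (∞ : ℝ≥0∞) = ∑' _ : ℕ, 1 := by rw [ENNReal.tsum_const_eq_top_of_ne_zero one_ne_zero]
          _ ≤ _ := ENNReal.tsum_le_tsum fun n => one_le_pow₀ ha1.le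
      rw [this, ENNReal.mul_top hc, add_top]
    | coe k =>
      rw [tsum_indicator_tail_natCast _ hω, exp_mul_natCast, ← ha, one_add_mul_geom_sum ha1.le]
  · exact ne_top_of_le_ne_top ENNReal.ofReal_ne_top tsub_le_self

/-- At each point at most one term of the sum survives, and none if `T ≥ N`; hence only an
inequality. -/
theorem sum_pow_mul_measure_eq_le_expMoment {Ω : Type*} [MeasurableSpace Ω] (μ : Measure Ω) {T : Ω → ℕ∞}
    (hT : ∀ n : ℕ, MeasurableSet {ω | T ω = n}) (θ : ℝ) (N : ℕ) :
    ∑ k ∈ Finset.range N, ENNReal.ofReal (Real.exp θ) ^ k * μ {ω | T ω = k} ≤ expMoment θ T μ := by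
  simp_rw [← lintegral_indicator_const (hT _)]
  rw [← lintegral_finsetSum _ fun k _ => measurable_const.indicator (hT k)]
  refine lintegral_mono fun ω => ?_
  cases hω : T ω using ENat.recTopCoe with
  | top => simp [hω]
  | coe k =>
    rw [exp_mul_natCast]
    refine (Finset.sum_le_sum_of_ne_zero (t := {k}) fun n _ hn => ?_).trans_eq ?_
    · have := Set.mem_of_indicator_ne_zero hn
      rw [Set.mem_ofPred_eq, hω, Nat.cast_inj] at this
      simp [this]
    · simp [hω]

theorem measure_le_eq_sum {Ω : Type*} [MeasurableSpace Ω] (μ : Measure Ω) {T : Ω → ℕ∞}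
    (hT : ∀ n : ℕ, MeasurableSet {ω | T ω = n}) {A : Set Ω} (hA : MeasurableSet A) (n : ℕ) :
    μ ({ω | T ω ≤ n} ∩ A) = ∑ k ∈ Finset.range (n + 1), μ ({ω | T ω = k} ∩ A) := by
  rw [← measure_biUnion_finset _ fun k _ => (hT k).inter hA]
  · congr 1
    ext ω
    simp only [Set.mem_inter_iff, Set.mem_ofPred_eq, Set.mem_iUnion, Finset.mem_range, exists_prop]
    constructor
    · rintro ⟨h, hω⟩
      obtain ⟨k, hk⟩ := ENat.ne_top_iff_exists.1 (ne_top_of_le_ne_top (ENat.natCast_ne_top n) h)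
      rw [← hk, Nat.cast_le] at h
      exact ⟨k, by omega, hk.symm, hω⟩
    · rintro ⟨k, hk, h, hω⟩
      refine ⟨?_, hω⟩
      rw [h, Nat.cast_le]
      omega
  · intro k _ l _ hkl
    refine Set.disjoint_left.2 fun ω h₁ h₂ => hkl ?_
    exact Nat.cast_inj.1 (h₁.1.symm.trans h₂.1)

end Tail

/-! ### First-visit decomposition and the comparison of tails -/

section Renewal

theorem isStoppingTime_hittingTime {S Ω : Type*} [m : MeasurableSpace Ω] {ℱ : Filtration ℕ m}
    {X : ℕ → Ω → S} (hX : ∀ t i, MeasurableSet[ℱ t] {ω | X t ω = i}) (j : S) :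
    IsStoppingTime ℱ (hittingTime X j) := by
  intro n
  have : {ω | hittingTime X j ω ≤ n} = ⋃ k ∈ Finset.range (n + 1), {ω | X k ω = j} := by
    ext ω
    simp only [hittingTime, Set.mem_ofPred_eq, Set.mem_iUnion, Finset.mem_range, exists_prop]
    refine hittingAfter_le_iff.trans ?_
    simp
  refine this ▸ ?_
  exact Finset.measurableSet_biUnion _ fun k hk =>
    ℱ.mono (Nat.lt_succ_iff.1 (Finset.mem_range.1 hk)) _ (hX k j)

theorem apply_of_hittingTime_eq {S Ω : Type*} {X : ℕ → Ω → S} {j : S} {ω : Ω} {n : ℕ}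
    (h : hittingTime X j ω = n) : X n ω = j := by
  have := hittingAfter_mem_set_of_ne_top (u := X) (s := {j}) (n := 0) (ω := ω)
    (by rw [show hittingAfter X {j} 0 ω = (n : ℕ∞) from h]; exact ENat.natCast_ne_top n)
  rw [show hittingAfter X {j} 0 ω = (n : ℕ∞) from h] at this
  exact this

theorem hittingTime_le {S Ω : Type*} {X : ℕ → Ω → S} {j : S} {ω : Ω} {n : ℕ}
    (h : X n ω = j) : hittingTime X j ω ≤ n :=
  hittingAfter_le_of_mem (Nat.zero_le n) h

/-- The renewal equation for the first visit to `j` of a stationary chain. -/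
theorem sum_hittingTime_mul_pow {S Ω : Type*} [Fintype S] [DecidableEq S] [MeasurableSpace Ω]
    {P : Matrix S S ℝ} (hP : P ∈ Matrix.rowStochastic ℝ S) {p : S → ℝ}
    (hp : IsStationaryDistribution P p) (j : S) {μ : Measure Ω} {X : ℕ → Ω → S}
    (hX : IsMarkovChain P p X μ) (n : ℕ) :
    ∑ l ∈ Finset.range (n + 1),
      μ {ω | hittingTime X j ω = l} * ENNReal.ofReal ((P ^ (n - l)) j j) =
      ENNReal.ofReal (p j) := by
  have hM := hX.isMarkovWrt fun i k => Matrix.nonneg_of_mem_rowStochastic hP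
  have hτ := isStoppingTime_hittingTime hM.adapted j
  have hlaw : μ {ω | X n ω = j} = ENNReal.ofReal (p j) := by
    rw [hM.measure_eq hP hX, sum_ofReal_mul_pow_of_stationary hP hp]
  have hdec := measure_le_eq_sum μ (T := hittingTime X j)
    (fun k => (naturalFiltration hX.measurableSet_eq).le k _ (hτ.measurableSet_eq k))
    (hX.measurableSet_eq n j) n
  have hsub : {ω | X n ω = j} ⊆ {ω | hittingTime X j ω ≤ n} := fun ω hω => hittingTime_le hω
  rw [Set.inter_eq_right.2 hsub, hlaw] at hdec
  rw [hdec]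
  refine Finset.sum_congr rfl fun l hl => ?_
  have hln : l + (n - l) = n := Nat.add_sub_cancel' (Nat.lt_succ_iff.1 (Finset.mem_range.1 hl))
  have hA : {ω | hittingTime X j ω = l} ∩ {ω | X l ω = j} = {ω | hittingTime X j ω = l} :=
    Set.inter_eq_left.2 fun ω hω => apply_of_hittingTime_eq hω
  have := hM.measure_inter hP l (n - l) (hτ.measurableSet_eq l) j j
  rw [hln] at this
  erw [hA] at this
  exact this.symm

theorem IsStrongStationaryTime.measure_eq_and {S Ω : Type*} [MeasurableSpace Ω]
    {P : Matrix S S ℝ} {p ν : S → ℝ} {X : ℕ → Ω → S} {T : Ω → ℕ∞} {μ : Measure Ω}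
    (h : IsStrongStationaryTime P p ν X T μ) (t : ℕ) (i : S) :
    μ ({ω | T ω = t} ∩ {ω | X t ω = i}) = μ {ω | T ω = t} * ENNReal.ofReal (p i) := by
  rw [← h.law i, ← h.indep t i]
  congr 1
  ext ω
  refine and_congr_right fun hω => ?_
  have : stoppedValue X T ω = X t ω := by
    have hω : T ω = t := hω
    simp only [stoppedValue, hω]
    rfl
  rw [Set.mem_ofPred_eq, this]

/-- Once a strong stationary time has occurred, the chain is stationary. -/
theorem IsStrongStationaryTime.mul_measure_le {S Ω : Type*} [Fintype S] [DecidableEq S]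
    [MeasurableSpace Ω] {P : Matrix S S ℝ} (hP : P ∈ Matrix.rowStochastic ℝ S) {p ν : S → ℝ}
    (hp : IsStationaryDistribution P p) {X : ℕ → Ω → S} {T : Ω → ℕ∞} {μ : Measure Ω}
    (h : IsStrongStationaryTime P p ν X T μ) (n : ℕ) (j : S) :
    ENNReal.ofReal (p j) * μ {ω | T ω ≤ n} ≤ μ {ω | X n ω = j} := by
  obtain ⟨ℱ, hM, hT⟩ := h.stopping
  have hTk : ∀ k : ℕ, MeasurableSet {ω | T ω = k} := fun k => ℱ.le k _ (hT.measurableSet_eq k)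
  have hX := h.chain.measurableSet_eq
  -- On `{T = k}` the state at time `k` has law `p` independently of the event, and stationarity
  -- carries this law on to time `n`.
  have key : ∀ k ∈ Finset.range (n + 1), μ ({ω | T ω = k} ∩ {ω | X n ω = j}) =
      ENNReal.ofReal (p j) * μ {ω | T ω = k} := by
    intro k hk
    have hkn : k + (n - k) = n := Nat.add_sub_cancel' (Nat.lt_succ_iff.1 (Finset.mem_range.1 hk))
    rw [measure_eq_sum_fiber μ (hX k) ((hTk k).inter (hX n j)), mul_comm,
      ← sum_ofReal_mul_pow_of_stationary hP hp (n - k) j, Finset.mul_sum]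
    refine Finset.sum_congr rfl fun i _ => ?_
    have := hM.measure_inter hP k (n - k) (hT.measurableSet_eq k) i j
    rw [hkn] at this
    rw [Set.inter_right_comm, ← mul_assoc, ← h.measure_eq_and]
    exact this
  calc ENNReal.ofReal (p j) * μ {ω | T ω ≤ n}
      = μ ({ω | T ω ≤ n} ∩ {ω | X n ω = j}) := by
        have := measure_le_eq_sum μ hTk MeasurableSet.univ n
        simp only [Set.inter_univ] at this
        rw [measure_le_eq_sum μ hTk (hX n j), this, Finset.mul_sum]
        exact (Finset.sum_congr rfl key).symm
    _ ≤ _ := measure_mono Set.inter_subset_right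

/-- The point mass at `j` is written as row `j` of the identity matrix. -/
theorem ofReal_eq_add_restrictAway {S : Type*} [DecidableEq S] {p : S → ℝ}
    {j : S} (hj : p j < 1) (i : S) :
    ENNReal.ofReal (p i) = ENNReal.ofReal (p j) * ENNReal.ofReal ((1 : Matrix S S ℝ) j i) +
      ENNReal.ofReal (1 - p j) * ENNReal.ofReal (restrictAway p j i) := by
  have h1 : 0 < 1 - p j := sub_pos.2 hj
  rcases eq_or_ne i j with rfl | hij
  · simp [restrictAway]
  · rw [← ENNReal.ofReal_mul h1.le]
    simp [restrictAway, hij, hij.symm, h1.ne']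

/-- The return probabilities to `j` in terms of the chain started away from `j`. -/
theorem ofReal_mul_pow_add_eq {S Ω : Type*} [Fintype S] [DecidableEq S] [MeasurableSpace Ω]
    {P : Matrix S S ℝ} (hP : P ∈ Matrix.rowStochastic ℝ S) {p : S → ℝ}
    (hp : IsStationaryDistribution P p) {j : S} (hj : p j < 1) {μ : Measure Ω} {X : ℕ → Ω → S}
    (hX : IsMarkovChain P (restrictAway p j) X μ) (n : ℕ) :
    ENNReal.ofReal (p j) * ENNReal.ofReal ((P ^ n) j j) +
      ENNReal.ofReal (1 - p j) * μ {ω | X n ω = j} = ENNReal.ofReal (p j) := by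
  have hM := hX.isMarkovWrt fun i k => Matrix.nonneg_of_mem_rowStochastic hP
  rw [hM.measure_eq hP hX]
  conv_rhs =>
    rw [← sum_ofReal_mul_pow_of_stationary hP hp n j]
    enter [2, i]
    rw [ofReal_eq_add_restrictAway hj i, add_mul]
  rw [Finset.sum_add_distrib, Finset.mul_sum]
  congr 1
  · rw [Finset.sum_eq_single j]
    · simp
    · intro i _ hij
      simp [Matrix.one_apply_ne hij.symm]
    · simp
  · simp_rw [mul_assoc]

theorem measure_tail_add {Ω : Type*} [MeasurableSpace Ω] (μ : Measure Ω) [IsProbabilityMeasure μ]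
    {T : Ω → ℕ∞} (hT : ∀ n : ℕ, MeasurableSet {ω | (n : ℕ∞) < T ω}) (n : ℕ) :
    μ {ω | (n : ℕ∞) < T ω} + μ {ω | T ω ≤ n} = 1 := by
  rw [← prob_add_prob_compl (μ := μ) (hT n)]
  congr 2
  ext ω
  simp

/-- The hitting time of `j` is stochastically at most `B (T + W)`, where `W` is an independent copy
of it and `B` is an independent Bernoulli variable with mean `1 - p_j`. -/
theorem measure_hittingTime_tail_le {S Ω Ω₁ : Type*} [Fintype S] [DecidableEq S]
    [MeasurableSpace Ω] [MeasurableSpace Ω₁] {P : Matrix S S ℝ}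
    (hP : P ∈ Matrix.rowStochastic ℝ S) {p : S → ℝ} (hp : IsStationaryDistribution P p) {j : S}
    (hj₀ : 0 < p j) (hj : p j < 1) {μ : Measure Ω} [IsProbabilityMeasure μ] {X : ℕ → Ω → S}
    (hX : IsMarkovChain P p X μ) {μ₁ : Measure Ω₁} [IsProbabilityMeasure μ₁] {X₁ : ℕ → Ω₁ → S}
    {T : Ω₁ → ℕ∞} (hT : IsStrongStationaryTime P p (restrictAway p j) X₁ T μ₁) (n : ℕ) :
    μ {ω | (n : ℕ∞) < hittingTime X j ω} ≤ ENNReal.ofReal (1 - p j) *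
      (μ₁ {ω | (n : ℕ∞) < T ω} + ∑ k ∈ Finset.range (n + 1),
        μ₁ {ω | T ω = k} * μ {ω | ((n - k : ℕ) : ℕ∞) < hittingTime X j ω}) := by
  obtain ⟨ℱ, -, hTs⟩ := hT.stopping
  have hTk : ∀ k : ℕ, MeasurableSet {ω | T ω = k} := fun k => ℱ.le k _ (hTs.measurableSet_eq k)
  have hTt : ∀ k : ℕ, MeasurableSet {ω | (k : ℕ∞) < T ω} :=
    fun k => ℱ.le k _ (hTs.measurableSet_gt k)
  have hM := hX.isMarkovWrt fun i k => Matrix.nonneg_of_mem_rowStochastic hP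
  have hWs := isStoppingTime_hittingTime hM.adapted j
  have hWk : ∀ k : ℕ, MeasurableSet {ω | hittingTime X j ω = k} :=
    fun k => (naturalFiltration hX.measurableSet_eq).le k _ (hWs.measurableSet_eq k)
  have hWt : ∀ k : ℕ, MeasurableSet {ω | (k : ℕ∞) < hittingTime X j ω} :=
    fun k => (naturalFiltration hX.measurableSet_eq).le k _ (hWs.measurableSet_gt k)
  have hTle : ∀ k : ℕ, μ₁ {ω | T ω ≤ k} = ∑ l ∈ Finset.range (k + 1), μ₁ {ω | T ω = l} := by
    intro k
    simpa using measure_le_eq_sum μ₁ hTk MeasurableSet.univ k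
  have hWle : ∀ k : ℕ, μ {ω | hittingTime X j ω ≤ k} =
      ∑ l ∈ Finset.range (k + 1), μ {ω | hittingTime X j ω = l} := by
    intro k
    simpa using measure_le_eq_sum μ hWk MeasurableSet.univ k
  set π := ENNReal.ofReal (p j) with hπ
  set q := ENNReal.ofReal (1 - p j) with hq
  have hπq : q + π = 1 := by
    rw [hπ, hq, ← ENNReal.ofReal_add (sub_pos.2 hj).le hj₀.le]
    simp
  have hπ0 : π ≠ 0 := (ENNReal.ofReal_pos.2 hj₀).ne'
  have hπt : π ≠ ∞ := ENNReal.ofReal_ne_top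
  -- Mass of the restricted chain that has already become stationary puts at least the fraction `p
  -- j` on `j`; the total mass at `j` is `p j`, which limits the return probability. Dividing by `p
  -- j` needs it to be positive.
  have hreturn : ∀ k : ℕ, ENNReal.ofReal ((P ^ k) j j) + q * μ₁ {ω | T ω ≤ k} ≤ 1 := by
    intro k
    have h₁ := ofReal_mul_pow_add_eq hP hp hj hT.chain k
    have h₂ := hT.mul_measure_le hP hp k j
    rw [← ENNReal.mul_le_mul_iff_right hπ0 hπt, mul_one, mul_add, mul_left_comm]
    refine le_trans ?_ h₁.le
    gcongr
  -- For independent `W` and `T`, this is `P(W + T ≤ n)`, conditioned on `W`; `hswap` conditions on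
  -- `T` instead.
  set F := ∑ l ∈ Finset.range (n + 1), μ {ω | hittingTime X j ω = l} *
    μ₁ {ω | T ω ≤ (n - l : ℕ)} with hF
  have hlower : π + q * F ≤ μ {ω | hittingTime X j ω ≤ n} := by
    rw [hWle, hπ, ← sum_hittingTime_mul_pow hP hp j hX n, hF, Finset.mul_sum,
      ← Finset.sum_add_distrib]
    refine Finset.sum_le_sum fun l _ => ?_
    rw [mul_left_comm, ← mul_add]
    exact mul_le_of_le_one_right' (hreturn _)
  have hswap : F = ∑ k ∈ Finset.range (n + 1),
      μ₁ {ω | T ω = k} * μ {ω | hittingTime X j ω ≤ (n - k : ℕ)} := by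
    simp_rw [hF, hTle, hWle, Finset.mul_sum]
    rw [Finset.sum_comm' (t' := Finset.range (n + 1)) (s' := fun k => Finset.range (n - k + 1))
      (by intro x y; simp only [Finset.mem_range]; omega)]
    simp_rw [mul_comm]
  -- This is `P(W + T > n)`, so `R` and `F` are complementary.
  set R := μ₁ {ω | (n : ℕ∞) < T ω} + ∑ k ∈ Finset.range (n + 1),
    μ₁ {ω | T ω = k} * μ {ω | ((n - k : ℕ) : ℕ∞) < hittingTime X j ω} with hR
  have hone : R + F = 1 := by
    rw [hR, hswap, add_assoc, ← Finset.sum_add_distrib]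
    simp_rw [← mul_add, measure_tail_add μ hWt, mul_one]
    rw [← hTle, measure_tail_add μ₁ hTt]
  have hFt : π + q * F ≠ ∞ := ne_top_of_le_ne_top (measure_ne_top _ _) hlower
  rw [← ENNReal.add_le_add_iff_right hFt]
  calc μ {ω | (n : ℕ∞) < hittingTime X j ω} + (π + q * F)
      ≤ μ {ω | (n : ℕ∞) < hittingTime X j ω} + μ {ω | hittingTime X j ω ≤ n} := by gcongr
    _ = q * R + (π + q * F) := by
        rw [measure_tail_add μ hWt, add_left_comm, ← mul_add, hone, mul_one, add_comm, hπq]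

end Renewal

/-! ### Mixtures of strong stationary times -/

section Mixture

theorem IsStrongStationaryTime.measurableSet_tail {S Ω : Type*} [MeasurableSpace Ω]
    {P : Matrix S S ℝ} {p ν : S → ℝ} {X : ℕ → Ω → S} {T : Ω → ℕ∞} {μ : Measure Ω}
    (h : IsStrongStationaryTime P p ν X T μ) (n : ℕ) : MeasurableSet {ω | (n : ℕ∞) < T ω} := by
  obtain ⟨ℱ, -, hT⟩ := h.stopping
  exact ℱ.le n _ (hT.measurableSet_gt n)

theorem IsStrongStationaryTime.measurableSet_eq {S Ω : Type*} [MeasurableSpace Ω]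
    {P : Matrix S S ℝ} {p ν : S → ℝ} {X : ℕ → Ω → S} {T : Ω → ℕ∞} {μ : Measure Ω}
    (h : IsStrongStationaryTime P p ν X T μ) (n : ℕ) : MeasurableSet {ω | T ω = n} := by
  obtain ⟨ℱ, -, hT⟩ := h.stopping
  exact ℱ.le n _ (hT.measurableSet_eq n)

theorem IsStrongStationaryTime.measurableSet_stoppedValue_eq {S Ω : Type*} [MeasurableSpace Ω]
    {P : Matrix S S ℝ} {p ν : S → ℝ} {X : ℕ → Ω → S} {T : Ω → ℕ∞} {μ : Measure Ω}
    (h : IsStrongStationaryTime P p ν X T μ) (i : S) :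
    MeasurableSet {ω | stoppedValue X T ω = i} := by
  have htop : MeasurableSet {ω | T ω = ⊤} := by
    have : {ω | T ω = ⊤} = ⋂ n : ℕ, {ω | (n : ℕ∞) < T ω} := by
      ext ω
      simp [ENat.eq_top_iff_forall_gt]
    rw [this]
    exact MeasurableSet.iInter h.measurableSet_tail
  -- The union includes `t = ⊤`, where `untopA` selects an arbitrary fixed time.
  have : {ω | stoppedValue X T ω = i} =
      ⋃ t : ℕ∞, {ω | T ω = t} ∩ {ω | X (WithTop.untopA t) ω = i} := by
    ext ω
    simp [stoppedValue]
  rw [this]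
  refine MeasurableSet.iUnion fun t => MeasurableSet.inter ?_ (h.chain.measurableSet_eq _ i)
  cases t using ENat.recTopCoe with
  | top => exact htop
  | coe k => exact h.measurableSet_eq k

/-- A finite mixture of strong stationary times, realised on the image of the underlying spaces,
is a strong stationary time from the mixture of the initial distributions. -/
theorem exists_mixture_of_maps {S ι : Type*} {Ω : ι → Type*} {Ω' : Type*} [Fintype ι]
    [∀ l, MeasurableSpace (Ω l)] {P : Matrix S S ℝ} {p ν : S → ℝ} (hP : ∀ i k, 0 ≤ P i k)
    {ν' : ι → S → ℝ} {μ : ∀ l, Measure (Ω l)} [∀ l, IsProbabilityMeasure (μ l)]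
    {X : ∀ l, ℕ → Ω l → S} {T : ∀ l, Ω l → ℕ∞}
    (h : ∀ l, IsStrongStationaryTime P p (ν' l) (X l) (T l) (μ l))
    {w : ι → ℝ≥0∞} (hw : ∑ l, w l = 1)
    (hν : ∀ i, ENNReal.ofReal (ν i) = ∑ l, w l * ENNReal.ofReal (ν' l i))
    {φ : ∀ l, Ω l → Ω'} {X' : ℕ → Ω' → S} {T' : Ω' → ℕ∞}
    (hX : ∀ l t ω, X' t (φ l ω) = X l t ω) (hT : ∀ l ω, T' (φ l ω) = T l ω) :
    ∃ (_ : MeasurableSpace Ω') (μ' : Measure Ω'), IsProbabilityMeasure μ' ∧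
      IsStrongStationaryTime P p ν X' T' μ' ∧ mean T' μ' = ∑ l, w l * mean (T l) (μ l) := by
  -- The largest σ-algebra making every `φ l` measurable: an event is measurable exactly when all
  -- its pullbacks are, so each property is checked on the components.
  let m' : MeasurableSpace Ω' := ⨅ l, MeasurableSpace.map (φ l) inferInstance
  have hmeas : ∀ A : Set Ω', MeasurableSet[m'] A ↔ ∀ l, MeasurableSet (φ l ⁻¹' A) := by
    intro A
    exact MeasurableSpace.measurableSet_iInf
  have hφ : ∀ l, Measurable[_, m'] (φ l) := fun l A hA => (hmeas A).1 hA l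
  let μ' : Measure Ω' := ∑ l, w l • (μ l).map (φ l)
  have hμ' : ∀ A : Set Ω', MeasurableSet A → μ' A = ∑ l, w l * μ l (φ l ⁻¹' A) := by
    intro A hA
    simp only [μ', Measure.finsetSum_apply, Measure.smul_apply, smul_eq_mul]
    exact Finset.sum_congr rfl fun l _ => by rw [Measure.map_apply (hφ l) hA]
  have hXT : ∀ l ω, stoppedValue X' T' (φ l ω) = stoppedValue (X l) (T l) ω := by
    intro l ω
    simp only [stoppedValue, hT, hX]
  have hmX : ∀ t i, MeasurableSet {ω | X' t ω = i} := by
    intro t i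
    rw [hmeas]
    intro l
    simpa only [Set.preimage_ofPred_eq, hX] using (h l).chain.measurableSet_eq t i
  have hmT : ∀ n : ℕ, MeasurableSet {ω | T' ω = n} := by
    intro n
    rw [hmeas]
    intro l
    simpa only [Set.preimage_ofPred_eq, hT] using (h l).measurableSet_eq n
  have hmtail : ∀ n : ℕ, MeasurableSet {ω | (n : ℕ∞) < T' ω} := by
    intro n
    rw [hmeas]
    intro l
    simpa only [Set.preimage_ofPred_eq, hT] using (h l).measurableSet_tail n
  have hmXT : ∀ i, MeasurableSet {ω | stoppedValue X' T' ω = i} := by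
    intro i
    rw [hmeas]
    intro l
    simpa only [Set.preimage_ofPred_eq, hXT] using (h l).measurableSet_stoppedValue_eq i
  have hlaw : ∀ i, μ' {ω | stoppedValue X' T' ω = i} = ENNReal.ofReal (p i) := by
    intro i
    rw [hμ' _ (hmXT i)]
    simp only [Set.preimage_ofPred_eq, hXT, (h _).law]
    rw [← Finset.sum_mul, hw, one_mul]
  refine ⟨m', μ', ⟨?_⟩, ⟨⟨hmX, ?_⟩, ?_, ?_, hlaw, ?_⟩, ?_⟩
  · rw [hμ' _ MeasurableSet.univ]
    simp [hw]
  · intro n x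
    have : MeasurableSet {ω | ∀ t ≤ n, X' t ω = x t} := by
      have : {ω | ∀ t ≤ n, X' t ω = x t} = ⋂ t, ⋂ _ : t ≤ n, {ω | X' t ω = x t} := by
        ext ω
        simp
      rw [this]
      exact MeasurableSet.iInter fun t => MeasurableSet.iInter fun _ => hmX t _
    rw [hμ' _ this]
    simp only [Set.preimage_ofPred_eq, hX, (h _).chain.path_law]
    have hprod : 0 ≤ ∏ t ∈ Finset.range n, P (x t) (x (t + 1)) :=
      Finset.prod_nonneg fun t _ => hP _ _
    simp_rw [ENNReal.ofReal_mul' hprod]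
    rw [hν, Finset.sum_mul]
    simp_rw [mul_assoc]
  · choose ℱ hM hS using fun l => (h l).stopping
    -- The same construction at each time keeps the extra randomness of the filtrations `ℱ l`, and
    -- the Markov identity, being linear in the measure, passes to the mixture.
    let ℱ' : Filtration ℕ m' :=
      { seq := fun t => ⨅ l, MeasurableSpace.map (φ l) (ℱ l t)
        mono' := fun s t hst => iInf_mono fun l => MeasurableSpace.map_mono ((ℱ l).mono hst)
        le' := fun t => iInf_mono fun l => MeasurableSpace.map_mono ((ℱ l).le t) }
    have hℱ : ∀ t (A : Set Ω'), MeasurableSet[ℱ' t] A ↔ ∀ l, MeasurableSet[ℱ l t] (φ l ⁻¹' A) := by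
      intro t A
      exact MeasurableSpace.measurableSet_iInf
    refine ⟨ℱ', ⟨?_, ?_⟩, ?_⟩
    · intro t i
      rw [hℱ]
      intro l
      simpa only [Set.preimage_ofPred_eq, hX] using (hM l).adapted t i
    · intro t A hA i k
      have hA' := ℱ'.le t A hA
      rw [hμ' _ ((hA'.inter (hmX t i)).inter (hmX (t + 1) k)), hμ' _ (hA'.inter (hmX t i)),
        Finset.sum_mul]
      refine Finset.sum_congr rfl fun l _ => ?_
      simp only [Set.preimage_inter, Set.preimage_ofPred_eq, hX]
      rw [(hM l).markov t _ ((hℱ t A).1 hA l) i k, mul_assoc]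
    · intro t
      rw [hℱ]
      intro l
      have := hS l t
      simpa only [Set.preimage_ofPred_eq, hT] using this
  · rw [ae_iff]
    have hfin : {ω | ¬ T' ω ≠ ⊤} = ⋂ n : ℕ, {ω | (n : ℕ∞) < T' ω} := by
      ext ω
      simp [ENat.eq_top_iff_forall_gt]
    have : MeasurableSet {ω | ¬ T' ω ≠ ⊤} := by
      rw [hfin]
      exact MeasurableSet.iInter hmtail
    rw [hμ' _ this]
    simp only [Set.preimage_ofPred_eq, hT]
    exact Finset.sum_eq_zero fun l _ => by rw [ae_iff.1 (h l).finite, mul_zero]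
  · intro t i
    have hmTS : MeasurableSet {ω | T' ω = t ∧ stoppedValue X' T' ω = i} :=
      (hmT t).inter (hmXT i)
    rw [hlaw, hμ' _ hmTS, hμ' _ (hmT t), Finset.sum_mul]
    refine Finset.sum_congr rfl fun l _ => ?_
    simp only [Set.preimage_ofPred_eq, hT, hXT]
    rw [(h l).indep t i, (h l).law, mul_assoc]
  · rw [mean_eq_tsum μ' hmtail]
    simp_rw [fun l => mean_eq_tsum (μ l) (h l).measurableSet_tail, ← ENNReal.tsum_mul_left]
    rw [← Summable.tsum_finsetSum fun _ _ => ENNReal.summable]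
    refine tsum_congr fun n => ?_
    rw [hμ' _ (hmtail n)]
    simp only [Set.preimage_ofPred_eq, hT]

/-- Finite mixtures of strong stationary times exist on a space in `Type`. -/
theorem exists_mixture {S ι : Type*} [Fintype S] {Ω : ι → Type*} [Fintype ι]
    [∀ l, MeasurableSpace (Ω l)] {P : Matrix S S ℝ} {p ν : S → ℝ} (hP : ∀ i k, 0 ≤ P i k)
    {ν' : ι → S → ℝ} {μ : ∀ l, Measure (Ω l)} [∀ l, IsProbabilityMeasure (μ l)]
    {X : ∀ l, ℕ → Ω l → S} {T : ∀ l, Ω l → ℕ∞}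
    (h : ∀ l, IsStrongStationaryTime P p (ν' l) (X l) (T l) (μ l))
    {w : ι → ℝ≥0∞} (hw : ∑ l, w l = 1)
    (hν : ∀ i, ENNReal.ofReal (ν i) = ∑ l, w l * ENNReal.ofReal (ν' l i)) :
    ∃ (Ω' : Type) (_ : MeasurableSpace Ω') (μ' : Measure Ω') (X' : ℕ → Ω' → S) (T' : Ω' → ℕ∞),
      IsProbabilityMeasure μ' ∧ IsStrongStationaryTime P p ν X' T' μ' ∧
        mean T' μ' = ∑ l, w l * mean (T l) (μ l) := by
  let e := Fintype.equivFin S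
  -- Only the path and the time matter, so they are recorded on a sequence space. Relabelling `S` by
  -- `Fin` puts it in `Type`, where the competitors of a fastest time live.
  obtain ⟨m', μ', h'⟩ := exists_mixture_of_maps hP h hw hν
    (Ω' := (ℕ → Fin (Fintype.card S)) × ℕ∞)
    (φ := fun l ω => (fun t => e (X l t ω), T l ω)) (X' := fun t ω => e.symm (ω.1 t))
    (T' := Prod.snd) (fun l t ω => by simp) (fun l ω => rfl)
  exact ⟨_, m', μ', _, _, h'⟩

end Mixture

/-! ### Moment bounds and the mixture away from `j` -/

section Bounds

theorem IsStationaryDistribution.pos {S : Type*} [Fintype S] [DecidableEq S] {P : Matrix S S ℝ}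
    (hP : P ∈ Matrix.rowStochastic ℝ S) (hirr : P.IsIrreducible) {p : S → ℝ}
    (hp : IsStationaryDistribution P p) (k : S) : 0 < p k := by
  obtain ⟨i, hi⟩ : ∃ i, 0 < p i := by
    by_contra! hneg
    have : ∑ i, p i ≤ 0 := Finset.sum_nonpos fun i _ => hneg i
    rw [hp.1.2] at this
    linarith
  obtain ⟨n, -, hn⟩ := (Matrix.isIrreducible_iff_exists_pow_pos hirr.nonneg).1 hirr i k
  rw [← congrFun (vecMul_pow_of_stationary hp n) k]
  exact (mul_pos hi hn).trans_le (Finset.single_le_sum (f := fun i => p i * (P ^ n) i k)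
    (fun l _ => mul_nonneg (hp.1.1 l) (pow_nonneg_of_rowStochastic hP n l k)) (Finset.mem_univ i))

theorem IsStationaryDistribution.lt_one {S : Type*} [Fintype S] [DecidableEq S] [Nontrivial S]
    {P : Matrix S S ℝ} (hP : P ∈ Matrix.rowStochastic ℝ S) (hirr : P.IsIrreducible) {p : S → ℝ}
    (hp : IsStationaryDistribution P p) (j : S) : p j < 1 := by
  obtain ⟨l, hl⟩ := exists_ne j
  have : p j + p l ≤ ∑ i, p i := by
    rw [← Finset.sum_pair hl.symm]
    exact Finset.sum_le_sum_of_subset_of_nonneg (Finset.subset_univ _) fun i _ _ => hp.1.1 i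
  rw [hp.1.2] at this
  linarith [hp.pos hP hirr l]


theorem measurableSet_hittingTime_tail {S Ω : Type*} [Fintype S] [MeasurableSpace Ω]
    {P : Matrix S S ℝ} {ν : S → ℝ} {X : ℕ → Ω → S} {μ : Measure Ω} (hX : IsMarkovChain P ν X μ)
    (j : S) (n : ℕ) : MeasurableSet {ω | (n : ℕ∞) < hittingTime X j ω} :=
  (naturalFiltration hX.measurableSet_eq).le n _ ((isStoppingTime_hittingTime
    (ℱ := naturalFiltration hX.measurableSet_eq)
    (fun t i => ⟨{y | y (Fin.last t) = i}, trivial, rfl⟩) j).measurableSet_gt n)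

/-- The mean hitting time of `j` is bounded by that of any strong stationary time from the
stationary distribution conditioned away from `j`. -/
theorem mean_hittingTime_le {S Ω Ω₁ : Type*} [Fintype S] [DecidableEq S]
    [MeasurableSpace Ω] [MeasurableSpace Ω₁] {P : Matrix S S ℝ}
    (hP : P ∈ Matrix.rowStochastic ℝ S) {p : S → ℝ} (hp : IsStationaryDistribution P p) {j : S}
    (hj₀ : 0 < p j) (hj : p j < 1) {μ : Measure Ω} [IsProbabilityMeasure μ] {X : ℕ → Ω → S}
    (hX : IsMarkovChain P p X μ) {μ₁ : Measure Ω₁} [IsProbabilityMeasure μ₁] {X₁ : ℕ → Ω₁ → S}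
    {T : Ω₁ → ℕ∞} (hT : IsStrongStationaryTime P p (restrictAway p j) X₁ T μ₁) :
    mean (hittingTime X j) μ ≤ ENNReal.ofReal ((1 - p j) / p j) * mean T μ₁ := by
  -- With `a = 1` the bound `m = 1` is on the total mass of `T`, and the denominator is `1 - q = p
  -- j`.
  have h := tsum_pow_mul_le_of_renewal (a := 1) (m := 1) ENNReal.one_ne_top
    (fun n => measure_ne_top μ {ω | (n : ℕ∞) < hittingTime X j ω})
    (by rw [mul_one, ENNReal.ofReal_lt_one]; linarith)
    (t := fun k => μ₁ {ω | T ω = k}) (fun N => by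
      simp only [one_pow, one_mul]
      cases N with
      | zero => simp
      | succ N =>
        have := measure_le_eq_sum μ₁ hT.measurableSet_eq MeasurableSet.univ N
        simp only [Set.inter_univ] at this
        rw [← this]
        exact prob_le_one)
    (measure_hittingTime_tail_le hP hp hj₀ hj hX hT)
  simp only [one_pow, one_mul, mul_one] at h
  have hden : 1 - ENNReal.ofReal (1 - p j) = ENNReal.ofReal (p j) := by
    rw [← ENNReal.ofReal_one, ← ENNReal.ofReal_sub _ (sub_pos.2 hj).le]
    simp
  rw [← mean_eq_tsum μ (measurableSet_hittingTime_tail hX j),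
    ← mean_eq_tsum μ₁ hT.measurableSet_tail, hden] at h
  refine h.trans_eq ?_
  rw [ENNReal.ofReal_div_of_pos hj₀, div_eq_mul_inv, div_eq_mul_inv, mul_right_comm]

/-- Exponential moments of the hitting time of `j` are at most those of a geometric sum of
independent copies of a strong stationary time. -/
theorem expMoment_hittingTime_le {S Ω Ω₁ : Type*} [Fintype S] [DecidableEq S]
    [MeasurableSpace Ω] [MeasurableSpace Ω₁] {P : Matrix S S ℝ}
    (hP : P ∈ Matrix.rowStochastic ℝ S) {p : S → ℝ} (hp : IsStationaryDistribution P p) {j : S}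
    (hj₀ : 0 < p j) (hj : p j < 1) {μ : Measure Ω} [IsProbabilityMeasure μ] {X : ℕ → Ω → S}
    (hX : IsMarkovChain P p X μ) {μ₁ : Measure Ω₁} [IsProbabilityMeasure μ₁] {X₁ : ℕ → Ω₁ → S}
    {T : Ω₁ → ℕ∞} (hT : IsStrongStationaryTime P p (restrictAway p j) X₁ T μ₁) {θ : ℝ} (hθ : 0 < θ)
    (hlt : ENNReal.ofReal (1 - p j) * expMoment θ T μ₁ < 1) :
    expMoment θ (hittingTime X j) μ ≤
      ENNReal.ofReal (p j) / (1 - ENNReal.ofReal (1 - p j) * expMoment θ T μ₁) := by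
  have h := tsum_pow_mul_le_of_renewal (a := ENNReal.ofReal (Real.exp θ)) (m := expMoment θ T μ₁)
    ENNReal.ofReal_ne_top (fun n => measure_ne_top μ {ω | (n : ℕ∞) < hittingTime X j ω}) hlt
    (t := fun k => μ₁ {ω | T ω = k})
    (sum_pow_mul_measure_eq_le_expMoment μ₁ hT.measurableSet_eq θ)
    (measure_hittingTime_tail_le hP hp hj₀ hj hX hT)
  have hmT := expMoment_eq_tsum μ₁ hT.measurableSet_tail hθ
  rw [expMoment_eq_tsum μ (measurableSet_hittingTime_tail hX j) hθ]
  set c := ENNReal.ofReal (Real.exp θ) - 1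
  set M := expMoment θ T μ₁
  set q := ENNReal.ofReal (1 - p j) with hq
  set B := ∑' n : ℕ, ENNReal.ofReal (Real.exp θ) ^ n * μ₁ {ω | (n : ℕ∞) < T ω}
  have hπq : q + ENNReal.ofReal (p j) = 1 := by
    rw [hq, ← ENNReal.ofReal_add (sub_pos.2 hj).le hj₀.le]
    simp
  have hd0 : 1 - q * M ≠ 0 := (tsub_pos_of_lt hlt).ne'
  have hdt : 1 - q * M ≠ ∞ := ne_top_of_le_ne_top ENNReal.one_ne_top tsub_le_self
  -- Since `M = 1 + c * B`, adding `q * M` to either side gives `1 + c * (q * B)`.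
  have hnum : (1 - q * M) + c * (q * B) = ENNReal.ofReal (p j) := by
    rw [← ENNReal.add_right_inj (ne_top_of_lt hlt), ← add_assoc, add_tsub_cancel_of_le hlt.le,
      hmT, mul_add, mul_one, add_right_comm, hπq, mul_left_comm]
  calc 1 + c * ∑' n : ℕ, ENNReal.ofReal (Real.exp θ) ^ n * μ {ω | (n : ℕ∞) < hittingTime X j ω}
      ≤ 1 + c * (q * B / (1 - q * M)) := by gcongr
    _ = ENNReal.ofReal (p j) / (1 - q * M) := by
        rw [← hnum, ENNReal.add_div, ENNReal.div_self hd0 hdt, ← mul_div_assoc]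

/-- A strong stationary time from the stationary distribution conditioned away from `j`, obtained
by mixing strong stationary times from the states other than `j`. -/
theorem exists_mixture_restrictAway {S : Type*} [Fintype S] [DecidableEq S] {P : Matrix S S ℝ}
    (hP : P ∈ Matrix.rowStochastic ℝ S) {p : S → ℝ} (hp : IsStationaryDistribution P p) {j : S}
    (hj₀ : 0 < p j) (hj : p j < 1) {Ω₂ : S → Type*} [∀ l, MeasurableSpace (Ω₂ l)]
    {μ₂ : ∀ l, Measure (Ω₂ l)} [∀ l, IsProbabilityMeasure (μ₂ l)] {X₂ : ∀ l, ℕ → Ω₂ l → S}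
    {T₂ : ∀ l, Ω₂ l → ℕ∞}
    (h : ∀ l, l ≠ j → IsStrongStationaryTime P p (Pi.single l 1) (X₂ l) (T₂ l) (μ₂ l)) :
    ∃ (Ω' : Type) (_ : MeasurableSpace Ω') (μ' : Measure Ω') (X' : ℕ → Ω' → S) (T' : Ω' → ℕ∞),
      IsProbabilityMeasure μ' ∧ IsStrongStationaryTime P p (restrictAway p j) X' T' μ' ∧
        ENNReal.ofReal ((1 - p j) / p j) * mean T' μ' = ENNReal.ofReal (1 / p j) *
          ∑ l ∈ Finset.univ.erase j, ENNReal.ofReal (p l) * mean (T₂ l) (μ₂ l) := by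
  have h1 : 0 < 1 - p j := sub_pos.2 hj
  -- The mixture is indexed by the subtype because nothing is assumed about `T₂ j`.
  have hsub : ∀ f : S → ℝ≥0∞, ∑ l : {l // l ≠ j}, f l = ∑ l ∈ Finset.univ.erase j, f l := by
    intro f
    exact (Finset.sum_subtype _ (by simp) f).symm
  have hw : ∑ l : {l // l ≠ j}, ENNReal.ofReal (p l / (1 - p j)) = 1 := by
    rw [hsub fun l => ENNReal.ofReal (p l / (1 - p j)),
      ← ENNReal.ofReal_sum_of_nonneg fun l _ => div_nonneg (hp.1.1 l) h1.le, ← Finset.sum_div,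
      Finset.sum_erase_eq_sub (Finset.mem_univ j), hp.1.2, div_self h1.ne', ENNReal.ofReal_one]
  obtain ⟨Ω', m', μ', X', T', hprob, hsst, hmean⟩ := exists_mixture
    (fun i k => Matrix.nonneg_of_mem_rowStochastic hP) (fun l : {l // l ≠ j} => h l l.2) hw
    (ν := restrictAway p j) (by
      intro i
      rw [hsub fun l => ENNReal.ofReal (p l / (1 - p j)) *
        ENNReal.ofReal ((Pi.single l 1 : S → ℝ) i)]
      rcases eq_or_ne i j with rfl | hij
      · rw [Finset.sum_eq_zero fun l hl => ?_]
        · simp [restrictAway]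
        · simp [(Finset.ne_of_mem_erase hl).symm]
      · rw [Finset.sum_eq_single i]
        · simp [restrictAway, hij, div_eq_inv_mul]
        · intro l _ hl
          simp [hl.symm]
        · simp [hij])
  refine ⟨Ω', m', μ', X', T', hprob, hsst, ?_⟩
  rw [hmean, hsub fun l => ENNReal.ofReal (p l / (1 - p j)) * mean (T₂ l) (μ₂ l), Finset.mul_sum,
    Finset.mul_sum]
  refine Finset.sum_congr rfl fun l _ => ?_
  rw [← mul_assoc, ← mul_assoc, ← ENNReal.ofReal_mul (by positivity),
    ← ENNReal.ofReal_mul (by positivity)]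
  congr 2
  field_simp

end Bounds

end HittingChain

theorem mainTheorem3 {S : Type*} [Fintype S] [DecidableEq S] [Nontrivial S]
    (P : Matrix S S ℝ) (hP : P ∈ Matrix.rowStochastic ℝ S)
    (hirr : P.IsIrreducible) (haper : HittingChain.IsAperiodic P)
    (p : S → ℝ) (hp : HittingChain.IsStationaryDistribution P p) (j : S)
    -- the stationary chain `X`, with hitting time `W_j = hittingTime X j`
    {Ω : Type*} [MeasurableSpace Ω] (μ : Measure Ω) [IsProbabilityMeasure μ]
    (X : ℕ → Ω → S) (hX : HittingChain.IsMarkovChain P p X μ) :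
    -- any strong stationary time `T` for a chain started from `restrictAway p j`
    (∀ {Ω₁ : Type*} [MeasurableSpace Ω₁] (μ₁ : Measure Ω₁) [IsProbabilityMeasure μ₁]
        (X₁ : ℕ → Ω₁ → S) (T : Ω₁ → ℕ∞),
        HittingChain.IsStrongStationaryTime P p (HittingChain.restrictAway p j) X₁ T μ₁ →
        HittingChain.mean (HittingChain.hittingTime X j) μ ≤
            ENNReal.ofReal ((1 - p j) / p j) * HittingChain.mean T μ₁ ∧
          ∀ θ : ℝ, 0 < θ →
            ENNReal.ofReal (1 - p j) * HittingChain.expMoment θ T μ₁ < 1 →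
            HittingChain.expMoment θ (HittingChain.hittingTime X j) μ ≤
              ENNReal.ofReal (p j) /
                (1 - ENNReal.ofReal (1 - p j) * HittingChain.expMoment θ T μ₁)) ∧
    -- any strong stationary times `T₂ l` for chains started from the states `l ≠ j`
    (∀ {Ω₂ : S → Type*} [∀ l, MeasurableSpace (Ω₂ l)] (μ₂ : ∀ l, Measure (Ω₂ l))
        [∀ l, IsProbabilityMeasure (μ₂ l)] (X₂ : ∀ l, ℕ → Ω₂ l → S) (T₂ : ∀ l, Ω₂ l → ℕ∞),
        (∀ l, l ≠ j →
          HittingChain.IsStrongStationaryTime P p (Pi.single l 1) (X₂ l) (T₂ l) (μ₂ l)) →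
        HittingChain.mean (HittingChain.hittingTime X j) μ ≤
            ENNReal.ofReal (1 / p j) *
              ∑ l ∈ Finset.univ.erase j,
                ENNReal.ofReal (p l) * HittingChain.mean (T₂ l) (μ₂ l) ∧
          ∀ {Ω₁ : Type*} [MeasurableSpace Ω₁] (μ₁ : Measure Ω₁) [IsProbabilityMeasure μ₁]
            (X₁ : ℕ → Ω₁ → S) (T : Ω₁ → ℕ∞),
            HittingChain.IsFastestStrongStationaryTime P p (HittingChain.restrictAway p j)
              X₁ T μ₁ →
            ENNReal.ofReal ((1 - p j) / p j) * HittingChain.mean T μ₁ ≤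
              ENNReal.ofReal (1 / p j) *
                ∑ l ∈ Finset.univ.erase j,
                  ENNReal.ofReal (p l) * HittingChain.mean (T₂ l) (μ₂ l)) := by
  have hj₀ := hp.pos hP hirr j
  have hj := hp.lt_one hP hirr j
  refine ⟨fun μ₁ _ X₁ T hT => ⟨HittingChain.mean_hittingTime_le hP hp hj₀ hj hX hT,
    fun θ hθ hlt => HittingChain.expMoment_hittingTime_le hP hp hj₀ hj hX hT hθ hlt⟩,
    fun μ₂ _ X₂ T₂ h₂ => ?_⟩
  obtain ⟨Ω', m', μ', X', T', hprob, hsst, hmean⟩ :=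
    HittingChain.exists_mixture_restrictAway hP hp hj₀ hj h₂
  rw [← hmean]
  refine ⟨HittingChain.mean_hittingTime_le hP hp hj₀ hj hX hsst, fun μ₁ _ X₁ T hT => ?_⟩
  gcongr
  -- The stochastic order is tested on the inclusion of `ℕ∞` in `ℝ≥0∞`, which compares the means.
  exact hT.2 Ω' μ' X' T' hsst (fun n => (n : ℝ≥0∞)) ENat.toENNReal_mono
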